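/- Let $d\ge 0$ be an integer, let $D$ be a probability distribution on $\mathbb R^d\times\{\pm1\}$, and let $D_X$ be its marginal on $\mathbb R^d$. For $h:\mathbb R^d\to\mathbb R$ and $\gamma\ge 0$ put $\ell_\gamma(h,D)=\mathbb P_{(X,Y)\sim D}[Y\,h(X)\le\gamma]$, and for a labeled sample $S=((x_i,y_i))_{i=1}^n$, $n\ge1$, put $\ell_\gamma(h,S)=\frac1n|\{i: y_ih(x_i)\le\gamma\}|$. Let $\mathcal W=\{x\mapsto\langle x,w\rangle : w\in\mathbb R^d,\ \|w\|\le1\}$ and $\ell^*_\gamma(D)=\inf_{h\in\mathcal W}\ell_\gamma(h,D)$. A margin-error minimization (MEM) algorithm $\mathcal A$ assigns to every $\gamma>0$ a map $\mathcal A_\gamma$ which takes every labeled sample $S$ of every size $n\ge 1$ to some $\mathcal A_\gamma(S)\in\operatorname{argmin}_{h\in\mathcal W}\ell_\gamma(h,S)$. Put $$\ell_0(\mathcal A_\gamma,D,n,\delta)=\inf\{\epsilon'\ge0 : \mathbb P_{S\sim D^n}[\ell_0(\mathcal A_\gamma(S),D)\ge\epsilon']\le\delta\}.$$ The sample complexity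 $m(\epsilon,\gamma,D,\delta)\in\{1,2,\dots\}\cup\{\infty\}$ is the least $m\ge1$ such that $\ell_0(\mathcal A_\gamma,D,n,\delta)-\ell^*_\gamma(D)\le\epsilon$ for every MEM algorithm $\mathcal A$ and every $n\ge m$ (and $\infty$ if there is no such $m$). The margin-adapted dimension $k_\gamma(D_X)$ is the least integer $k\ge1$ for which there is a linear subspace $V\subseteq\mathbb R^d$ of dimension $d-k$ with $\mathbb E_{X\sim D_X}[\|O_VX\|^2]\le\gamma^2k$, where $O_V$ is the orthogonal projection onto $V$ (for $d=0$, put $k_\gamma(D_X)=0$). A real random variable $Z$ is sub-Gaussian with moment $B\ge0$ if $\mathbb E[e^{tZ}]\le e^{t^2B^2/2}$ for all $t\in\mathbb R$, and it has relative moment $\rho>0$ if it is sub-Gaussian with moment $\rho\sqrt{\mathbb E[Z^2]}$. Let $\mathcal D_\rho$ be the family of all distributions on some $\mathbb R^d$ ($d$ arbitrary) for which there are an orthonormal basis $a_1,\dots,a_d$ of $\mathbb R^d$ and a $B\ge0$ such that, for $X$ with that distribution, $\langle a_1,X\rangle,\dots,\langle a_d,X\rangle$ are independent and each is sub-Gaussian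 with moment $B$ and with relative moment $\rho$. **Theorem.** For every $\rho>0$ there are constants $\beta>0$ and $C\ge0$, depending only on $\rho$, such that for every dimension $d$, every distribution $D$ on $\mathbb R^d\times\{\pm1\}$ with $D_X\in\mathcal D_\rho$, every $\gamma>0$ and every real $\epsilon<\frac12-\ell^*_\gamma(D)$, $$m(\epsilon,\gamma,D,1/4)\ \ge\ \beta\,k_\gamma(D_X)-C.$$ -/

import Mathlib

open MeasureTheory ProbabilityTheory

noncomputable section

namespace MarginLearning

/-- The label set `{±1}`. -/
abbrev Label : Type := {y : ℝ // y = 1 ∨ y = -1}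

/-- The margin error `ℓ_γ(h, D) = P_{(X,Y) ∼ D}[Y · h(X) ≤ γ]`. For `γ = 0` this is the
misclassification error `ℓ_0(h, D)`. -/
def marginLoss {𝒳 : Type*} [MeasurableSpace 𝒳] (γ : ℝ) (h : 𝒳 → ℝ)
    (D : Measure (𝒳 × Label)) : ℝ :=
  D.real {p | (p.2 : ℝ) * h p.1 ≤ γ}

/-- The best achievable margin error `ℓ*_γ(H, D) = inf_{h ∈ H} ℓ_γ(h, D)`. -/
def bestMarginLoss {𝒳 : Type*} [MeasurableSpace 𝒳] (H : Set (𝒳 → ℝ)) (γ : ℝ)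
    (D : Measure (𝒳 × Label)) : ℝ :=
  ⨅ h : H, marginLoss γ (h : 𝒳 → ℝ) D

/-- The empirical margin error of `h` on the labeled sample `S = ((x_i, y_i))_{i < n}`. -/
def empMarginLoss {𝒳 : Type*} (γ : ℝ) (h : 𝒳 → ℝ) {n : ℕ} (S : Fin n → 𝒳 × Label) : ℝ :=
  ((Finset.univ.filter fun i => ((S i).2 : ℝ) * h (S i).1 ≤ γ).card : ℝ) / n

/-- A learning algorithm maps a labeled sample of any size to a real-valued classifier.
(Its value on the empty sample is never used below.) -/
abbrev LearningAlgorithm (𝒳 : Type*) : Type _ :=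
  (n : ℕ) → (Fin n → 𝒳 × Label) → (𝒳 → ℝ)

/-- `A` is a margin-error minimization algorithm for the hypothesis class `H`: for every margin
`γ > 0` and every (nonempty) sample `S`, `A γ` returns a minimizer over `H` of the empirical
`γ`-margin error on `S`. -/
def IsMEM {𝒳 : Type*} (H : Set (𝒳 → ℝ)) (A : ℝ → LearningAlgorithm 𝒳) : Prop :=
  ∀ γ : ℝ, 0 < γ → ∀ n : ℕ, 1 ≤ n → ∀ S : Fin n → 𝒳 × Label,
    A γ n S ∈ H ∧ ∀ g ∈ H, empMarginLoss γ (A γ n S) S ≤ empMarginLoss γ g S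

/-- The high-probability misclassification loss
`ℓ_0(A, D, n, δ) = inf {ε ≥ 0 | P_{S ∼ D^n}[ℓ_0(A(S), D) ≥ ε] ≤ δ}`. -/
def highProbLoss {𝒳 : Type*} [MeasurableSpace 𝒳] (A : LearningAlgorithm 𝒳)
    (D : Measure (𝒳 × Label)) (n : ℕ) (δ : ℝ) : ℝ :=
  sInf {ε : ℝ | 0 ≤ ε ∧
    (Measure.pi fun _ : Fin n => D).real {S | ε ≤ marginLoss 0 (A n S) D} ≤ δ}

/-- The distribution-specific sample complexity `m(ε, γ, D, δ)` for the hypothesis class `H`: the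
least sample size `m ≥ 1` such that every MEM algorithm has excess error at most `ε` on samples of
any size `n ≥ m`. It is `⊤` if there is no such sample size. -/
def sampleComplexity {𝒳 : Type*} [MeasurableSpace 𝒳] (H : Set (𝒳 → ℝ)) (ε γ : ℝ)
    (D : Measure (𝒳 × Label)) (δ : ℝ) : ℕ∞ :=
  ⨅ m ∈ {m : ℕ | 1 ≤ m ∧ ∀ A : ℝ → LearningAlgorithm 𝒳, IsMEM H A → ∀ n : ℕ, m ≤ n →
    highProbLoss (A γ) D n δ - bestMarginLoss H γ D ≤ ε}, (m : ℕ∞)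

/-- The class of homogeneous linear separators `x ↦ ⟨x, w⟩` with `‖w‖ ≤ 1`. -/
def linearClass (d : ℕ) : Set (EuclideanSpace ℝ (Fin d) → ℝ) :=
  {h | ∃ w : EuclideanSpace ℝ (Fin d), ‖w‖ ≤ 1 ∧ h = fun x => inner ℝ x w}

/-- `P` is `(b, k)`-limited: for some subspace `V` of dimension `d - k`, the expected squared norm
of the orthogonal projection onto `V` is at most `b`. (The expectation may be infinite.) -/
def IsLimited {d : ℕ} (P : Measure (EuclideanSpace ℝ (Fin d))) (b : ℝ) (k : ℕ) : Prop :=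
  ∃ V : Submodule ℝ (EuclideanSpace ℝ (Fin d)), Module.finrank ℝ V + k = d ∧
    ∫⁻ x, ENNReal.ofReal (‖V.starProjection x‖ ^ 2) ∂P ≤ ENNReal.ofReal b

/-- The margin-adapted dimension `k_γ(P)`: the least positive integer `k` such that `P` is
`(γ²k, k)`-limited. For `d ≥ 1` such a `k` exists, since `k = d` is one; for `d = 0` there is none
and the value is `0`. -/
def marginAdaptedDim {d : ℕ} (γ : ℝ) (P : Measure (EuclideanSpace ℝ (Fin d))) : ℕ :=
  sInf {k : ℕ | 1 ≤ k ∧ IsLimited P (γ ^ 2 * k) k}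

/-- `X` is sub-Gaussian with moment `B`: `E[exp(tX)] ≤ exp(t²B²/2)` for all real `t`. -/
def IsSubGaussian {Ω : Type*} [MeasurableSpace Ω] (X : Ω → ℝ) (B : ℝ) (μ : Measure Ω) : Prop :=
  HasSubgaussianMGF X (Real.toNNReal (B ^ 2)) μ

/-- `X` is sub-Gaussian with relative moment `ρ`: it is sub-Gaussian with moment `ρ √E[X²]`. -/
def IsRelSubGaussian {Ω : Type*} [MeasurableSpace Ω] (X : Ω → ℝ) (ρ : ℝ) (μ : Measure Ω) : Prop :=
  IsSubGaussian X (ρ * Real.sqrt (∫ ω, X ω ^ 2 ∂μ)) μ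

/-- `P` is a sub-Gaussian product distribution with moment `B` and relative moment `ρ`. -/
def IsSubGaussianProduct {d : ℕ} (P : Measure (EuclideanSpace ℝ (Fin d))) (B ρ : ℝ) : Prop :=
  ∃ a : OrthonormalBasis (Fin d) ℝ (EuclideanSpace ℝ (Fin d)),
    iIndepFun (fun i x => inner ℝ (a i) x) P ∧
    ∀ i, IsSubGaussian (fun x => inner ℝ (a i) x) B P ∧
      IsRelSubGaussian (fun x => inner ℝ (a i) x) ρ P

/-- `P` belongs to the family `𝒟_ρ` of sub-Gaussian product distributions with relative
moment `ρ` (and some moment `B ≥ 0`). -/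
def InFamily {d : ℕ} (ρ : ℝ) (P : Measure (EuclideanSpace ℝ (Fin d))) : Prop :=
  ∃ B : ℝ, 0 ≤ B ∧ IsSubGaussianProduct P B ρ

end MarginLearning

end

namespace MarginLearning

/-! A sample shattered at margin `γ` leaves a margin minimizer free to err elsewhere. Split `2n`
points into two halves. If they are jointly shattered, some `w` in the unit ball fits the first half
and the negated labels of the second, so `w` minimizes on one half and `-w` on the other. The errors
of `w` and `-w` sum to at least one, hence one half admits a minimizer with error at least `1/2`. If
shattering has probability above `1/2`, an algorithm that prefers bad minimizers fails with
probability above `1/4` (`exists_isMEM_half_le_highProbLoss`).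

Shattering holds once the least eigenvalue of the Gram matrix exceeds the number of points times
`γ²` (`exists_norm_le_one_margin`). To bound that eigenvalue from below, measure lengths in units of
`γ` and shrink each coordinate of variance above one to variance one. The truncated variances still
sum to at least `k_γ - 1` (`marginAdaptedDim_sub_one_le`). Chernoff bounds, with exponent
proportional to this sum, control each fixed direction, and a net of the sphere makes them uniform
(`measureReal_exists_sum_sq_lt_le`). The net size is exponential in the sample size, so the bound is
useful while the sample is a small fraction of `k_γ`. -/

/-! ### Nets of the unit sphere -/

/-- Every finite `ε`-separated subset of the unit sphere has at most `(1 + 2 / ε) ^ dim` points. -/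
lemma card_le_of_separated_of_norm_eq_one {E : Type*} [NormedAddCommGroup E] [NormedSpace ℝ E]
    [FiniteDimensional ℝ E] {ε : ℝ} (hε : 0 < ε) (s : Finset E) (hs : ∀ c ∈ s, ‖c‖ = 1)
    (h : ∀ c ∈ s, ∀ d ∈ s, c ≠ d → ε ≤ ‖c - d‖) :
    (s.card : ℝ) ≤ (1 + 2 / ε) ^ Module.finrank ℝ E := by
  borelize E
  let μ : Measure E := Measure.addHaar
  have hr : 0 < 1 + ε / 2 := by positivity
  have hδ : 0 < ε / 2 := by positivity
  have hdisj : Set.Pairwise (s : Set E)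
      (Function.onFun Disjoint fun c => Metric.ball (c : E) (ε / 2)) := by
    rintro c hc d hd hcd
    apply Metric.ball_disjoint_ball
    rw [dist_eq_norm, add_halves]
    exact h c hc d hd hcd
  have hsub : (⋃ c ∈ s, Metric.ball (c : E) (ε / 2)) ⊆ Metric.ball (0 : E) (1 + ε / 2) := by
    refine Set.iUnion₂_subset fun x hx => Metric.ball_subset_ball' ?_
    rw [dist_zero_right, hs x hx, add_comm]
  have hvol : (s.card : ENNReal) * ENNReal.ofReal ((ε / 2) ^ Module.finrank ℝ E) *
      μ (Metric.ball 0 1) ≤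
      ENNReal.ofReal ((1 + ε / 2) ^ Module.finrank ℝ E) * μ (Metric.ball 0 1) :=
    calc
      _ = μ (⋃ c ∈ s, Metric.ball (c : E) (ε / 2)) := by
        rw [measure_biUnion_finset hdisj fun c _ => measurableSet_ball]
        simp only [μ.addHaar_ball_of_pos _ hδ, Finset.sum_const, nsmul_eq_mul, mul_assoc]
      _ ≤ μ (Metric.ball (0 : E) (1 + ε / 2)) := measure_mono hsub
      _ = _ := by simp only [μ.addHaar_ball_of_pos _ hr]
  have hcard := (ENNReal.mul_le_mul_iff_left
    (Metric.measure_ball_pos μ _ zero_lt_one).ne' measure_ball_lt_top.ne).1 hvol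
  have := ENNReal.toReal_le_of_le_ofReal (pow_nonneg hr.le _) hcard
  rw [ENNReal.toReal_mul, ENNReal.toReal_natCast, ENNReal.toReal_ofReal (by positivity),
    ← le_div_iff₀ (by positivity), ← div_pow] at this
  have hratio : (1 + ε / 2) / (ε / 2) = 1 + 2 / ε := by
    field_simp
    ring
  rwa [hratio] at this

/-- The unit sphere has an `ε`-net with at most `(1 + 2 / ε) ^ dim` points. -/
lemma exists_net_sphere (E : Type*) [NormedAddCommGroup E] [NormedSpace ℝ E]
    [FiniteDimensional ℝ E] {ε : ℝ} (hε : 0 < ε) :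
    ∃ s : Finset E, (∀ c ∈ s, ‖c‖ = 1) ∧ (∀ u : E, ‖u‖ = 1 → ∃ v ∈ s, ‖u - v‖ ≤ ε) ∧
      (s.card : ℝ) ≤ (1 + 2 / ε) ^ Module.finrank ℝ E := by
  classical
  let Sep : Finset E → Prop := fun s =>
    (∀ c ∈ s, ‖c‖ = 1) ∧ ∀ c ∈ s, ∀ d ∈ s, c ≠ d → ε ≤ ‖c - d‖
  let Q : ℕ → Prop := fun n => ∃ s : Finset E, Sep s ∧ s.card = n
  let M := ⌊(1 + 2 / ε) ^ Module.finrank ℝ E⌋₊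
  have hM : ∀ n, Q n → n ≤ M := by
    rintro n ⟨s, hs, rfl⟩
    exact Nat.le_floor (card_le_of_separated_of_norm_eq_one hε s hs.1 hs.2)
  have h0 : Q 0 := ⟨∅, ⟨by simp, by simp⟩, rfl⟩
  -- A separated set of maximal cardinality is a net: a point far from all of it could be adjoined.
  obtain ⟨s, hs, hcard⟩ := Nat.findGreatest_spec (P := Q) (Nat.zero_le M) h0
  refine ⟨s, hs.1, fun u hu => ?_, card_le_of_separated_of_norm_eq_one hε s hs.1 hs.2⟩
  by_contra! hfar
  have hus : u ∉ s := fun hmem => by simpa using (hfar u hmem).trans_le' hε.le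
  have hQ : Q (s.card + 1) := by
    refine ⟨insert u s, ⟨?_, ?_⟩, Finset.card_insert_of_notMem hus⟩
    · intro c hc
      rcases Finset.mem_insert.1 hc with rfl | hc
      exacts [hu, hs.1 c hc]
    · intro c hc d hd hcd
      rcases Finset.mem_insert.1 hc with hc' | hc' <;>
        rcases Finset.mem_insert.1 hd with hd' | hd'
      · exact absurd (hc'.trans hd'.symm) hcd
      · rw [hc']; exact (hfar d hd').le
      · rw [hd', norm_sub_rev]; exact (hfar c hc').le
      · exact hs.2 c hc' d hd' hcd
  have := Nat.le_findGreatest (hM _ hQ) hQ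
  omega

/-- Two-sided bounds for a linear map on a net of the unit sphere give a lower bound on the whole
sphere. -/
lemma le_norm_apply_of_net {E F : Type*} [NormedAddCommGroup E] [NormedSpace ℝ E]
    [NormedAddCommGroup F] [NormedSpace ℝ F] (L : E →L[ℝ] F)
    {ε a b : ℝ} (hε : ε ≤ 1 / 2) (hε0 : 0 ≤ ε) (hb : 0 ≤ b) {s : Finset E}
    (hnet : ∀ u : E, ‖u‖ = 1 → ∃ v ∈ s, ‖u - v‖ ≤ ε)
    (hs : ∀ v ∈ s, a ≤ ‖L v‖ ∧ ‖L v‖ ≤ b) {u : E} (hu : ‖u‖ = 1) :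
    a - 2 * b * ε ≤ ‖L u‖ := by
  have hstep : ∀ v w : E, ‖v - w‖ ≤ ε → ‖L v‖ ≤ ‖L w‖ + ‖L‖ * ε := fun v w hvw => by
    have h1 : ‖L v‖ ≤ ‖L w‖ + ‖L (v - w)‖ := by
      rw [map_sub]; exact norm_le_norm_add_norm_sub' _ _
    exact h1.trans (by gcongr; exact (L.le_opNorm _).trans (by gcongr))
  -- Self-bounding: the operator norm appears on both sides, and `ε ≤ 1/2` absorbs it into `‖L‖ ≤
  -- 2b`.
  have hL : ‖L‖ ≤ b + ‖L‖ * ε := by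
    refine L.opNorm_le_of_unit_norm (by positivity) fun x hx => ?_
    obtain ⟨v, hv, hxv⟩ := hnet x hx
    exact (hstep x v hxv).trans (by gcongr; exact (hs v hv).2)
  have hL2 : ‖L‖ ≤ 2 * b := by nlinarith [norm_nonneg L]
  obtain ⟨v, hv, huv⟩ := hnet u hu
  have h1 := hstep v u (by rwa [norm_sub_rev])
  have h2 : ‖L‖ * ε ≤ 2 * b * ε := by gcongr
  linarith [(hs v hv).1]

/-! ### Shattering from a Gram matrix bound -/

/-- If the Gram operator of the points `x i` is bounded below by `Λ > n γ²`, the points are shattered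
with margin `γ` by the unit ball: every sign pattern is realized. -/
lemma exists_norm_le_one_margin {ι : Type*} [Fintype ι] {E : Type*} [NormedAddCommGroup E]
    [InnerProductSpace ℝ E] [FiniteDimensional ℝ E] (x : ι → E) {γ Λ : ℝ} (hγ : 0 < γ)
    (hΛ : Fintype.card ι * γ ^ 2 < Λ)
    (hx : ∀ u : EuclideanSpace ℝ ι, ‖u‖ = 1 → Λ ≤ ‖∑ j, u j • x j‖ ^ 2)
    (y : ι → ℝ) (hy : ∀ j, y j ^ 2 = 1) :
    ∃ w : E, ‖w‖ ≤ 1 ∧ ∀ j, γ < y j * inner ℝ (x j) w := by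
  classical
  rcases isEmpty_or_nonempty ι with hι | hι
  · exact ⟨0, by simp, fun j => hι.elim j⟩
  have hΛ0 : 0 < Λ := hΛ.trans_le' (by positivity)
  have hxu : ∀ u : EuclideanSpace ℝ ι, Λ * ‖u‖ ^ 2 ≤ ‖∑ j, u j • x j‖ ^ 2 := fun u => by
    rcases eq_or_ne u 0 with rfl | hu
    · simp
    have hn : 0 < ‖u‖ := norm_pos_iff.2 hu
    have h1 := hx (‖u‖⁻¹ • u) (by rw [norm_smul, norm_inv, norm_norm]; field_simp)
    have h2 : ∑ j, (‖u‖⁻¹ • u) j • x j = ‖u‖⁻¹ • ∑ j, u j • x j := by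
      simp [Finset.smul_sum, smul_smul]
    rw [h2, norm_smul, norm_inv, norm_norm, mul_pow, inv_pow] at h1
    field_simp at h1
    linarith
  let G : (ι → ℝ) →ₗ[ℝ] (ι → ℝ) :=
    { toFun := fun u i => inner ℝ (x i) (∑ j, u j • x j)
      map_add' := fun u v => by
        ext i; simp [add_smul, Finset.sum_add_distrib, inner_add_right]
      map_smul' := fun r u => by
        ext i; simp [mul_smul, ← Finset.smul_sum, inner_smul_right] }
  have hG : ∀ u : ι → ℝ, ∑ i, u i * G u i = ‖∑ j, u j • x j‖ ^ 2 := fun u => by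
    rw [← real_inner_self_eq_norm_sq, sum_inner]
    simp [G, inner_smul_left]
  have hinj : Function.Injective G := by
    rw [injective_iff_map_eq_zero]
    intro u hu
    have h1 := hG u
    have h2 := hxu (WithLp.toLp 2 u)
    simp only [hu, Pi.zero_apply, mul_zero, Finset.sum_const_zero] at h1
    simp only [← h1] at h2
    have h3 : ‖WithLp.toLp 2 u‖ = 0 := by
      by_contra hne
      have : 0 < Λ * ‖WithLp.toLp 2 u‖ ^ 2 := by positivity
      linarith
    simpa using h3
  -- Inverting the Gram matrix gives `w₀` with inner products exactly `y j`; normalized, it has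
  -- margin `1 / ‖w₀‖`.
  obtain ⟨α, hα⟩ := (LinearMap.injective_iff_surjective.1 hinj) y
  set w₀ : E := ∑ j, α j • x j with hw₀
  have hin : ∀ j, inner ℝ (x j) w₀ = y j := fun j => congrFun hα j
  -- Cauchy–Schwarz for `‖w₀‖² = ⟨α, y⟩`. With `Λ‖α‖² ≤ ‖w₀‖²` it yields `Λ‖w₀‖² ≤ card ι`.
  have hcs : (‖w₀‖ ^ 2) ^ 2 ≤ ‖WithLp.toLp 2 α‖ ^ 2 * Fintype.card ι := by
    rw [← hG α, hα, EuclideanSpace.real_norm_sq_eq]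
    refine (Finset.sum_mul_sq_le_sq_mul_sq _ _ _).trans ?_
    simp [hy]
  have hlow := hxu (WithLp.toLp 2 α)
  have hn0 : 0 < ‖w₀‖ := by
    obtain ⟨j⟩ := hι
    refine norm_pos_iff.2 fun h0 => ?_
    have h1 := hin j
    have h2 := hy j
    rw [h0, inner_zero_right] at h1
    simp [← h1] at h2
  have hbound : γ < ‖w₀‖⁻¹ := by
    have h1 : Λ * ‖w₀‖ ^ 2 ≤ Fintype.card ι := by
      have h3 : Λ * ‖w₀‖ ^ 2 * ‖w₀‖ ^ 2 ≤ Fintype.card ι * ‖w₀‖ ^ 2 := by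
        have h4 := mul_le_mul_of_nonneg_left hcs hΛ0.le
        have h5 : Λ * ‖WithLp.toLp 2 α‖ ^ 2 * (Fintype.card ι : ℝ) ≤
            ‖w₀‖ ^ 2 * Fintype.card ι := by gcongr
        nlinarith
      exact le_of_mul_le_mul_right h3 (by positivity)
    have hc : (0 : ℝ) < Fintype.card ι := by exact_mod_cast Fintype.card_pos
    have h2 : (γ * ‖w₀‖) ^ 2 < 1 := by
      have h3 : Fintype.card ι * γ ^ 2 * ‖w₀‖ ^ 2 < Λ * ‖w₀‖ ^ 2 := by gcongr
      have h4 : (Fintype.card ι : ℝ) * (γ * ‖w₀‖) ^ 2 < Fintype.card ι * 1 := by nlinarith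
      exact lt_of_mul_lt_mul_left h4 hc.le
    have h3 : γ * ‖w₀‖ < 1 := by
      have : 0 < γ * ‖w₀‖ := by positivity
      nlinarith
    rwa [lt_inv_comm₀ hγ hn0, ← one_div, lt_div_iff₀ hγ, mul_comm]
  refine ⟨‖w₀‖⁻¹ • w₀, ?_, fun j => ?_⟩
  · rw [norm_smul, norm_inv, norm_norm, inv_mul_cancel₀ hn0.ne']
  · rw [inner_smul_right, hin, mul_left_comm, ← sq, hy, mul_one]
    exact hbound

/-! ### Squares of sub-Gaussian variables -/

/-- The integral equals `(1 - x)^(-1/2)`, which lies below the line `1 + 2x` on `[0, 3/4]`. -/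
lemma lintegral_exp_sq_gaussianReal_le {x : ℝ} (hx0 : 0 ≤ x) (hx : x ≤ 3 / 4) :
    ∫⁻ g, ENNReal.ofReal (Real.exp (x / 2 * g ^ 2)) ∂(gaussianReal 0 1) ≤
      ENNReal.ofReal (1 + 2 * x) := by
  have hb : 0 < (1 - x) / 2 := by linarith
  rw [gaussianReal_of_var_ne_zero _ one_ne_zero,
    lintegral_withDensity_eq_lintegral_mul _ (measurable_gaussianPDF 0 1) (by fun_prop)]
  have hpt : ∀ g : ℝ, (gaussianPDF 0 1 * fun g => ENNReal.ofReal (Real.exp (x / 2 * g ^ 2))) g =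
      ENNReal.ofReal ((√(2 * Real.pi))⁻¹ * Real.exp (-((1 - x) / 2) * g ^ 2)) := fun g => by
    rw [Pi.mul_apply, gaussianPDF, ← ENNReal.ofReal_mul (gaussianPDFReal_nonneg 0 1 g),
      gaussianPDFReal]
    simp only [NNReal.coe_one, mul_one, sub_zero, mul_assoc, ← Real.exp_add]
    congr 3
    ring
  rw [lintegral_congr hpt, ← ofReal_integral_eq_lintegral_ofReal
    ((integrable_exp_neg_mul_sq hb).const_mul _) (ae_of_all _ fun g => by positivity)]
  refine ENNReal.ofReal_le_ofReal ?_
  rw [integral_const_mul, integral_gaussian, ← Real.sqrt_inv, ← Real.sqrt_mul (by positivity)]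
  have h1 : (2 * Real.pi)⁻¹ * (Real.pi / ((1 - x) / 2)) = (1 - x)⁻¹ := by
    have := Real.pi_pos
    have : 1 - x ≠ 0 := by linarith
    field_simp
  rw [h1]
  refine Real.sqrt_le_iff.2 ⟨by linarith, ?_⟩
  rw [inv_le_iff_one_le_mul₀ (by linarith)]
  nlinarith [mul_nonneg hx0 (sub_nonneg.2 hx), mul_nonneg hx0 hx0,
    mul_nonneg (mul_nonneg hx0 hx0) (sub_nonneg.2 hx)]

section SubGaussian

variable {Ω : Type*} [MeasurableSpace Ω] {μ : Measure Ω} [IsProbabilityMeasure μ]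

/-- Jensen gives `t m ≤ v t² / 2` for every `t`; a small `t` with the sign of `m` forces `m = 0`. -/
lemma integral_eq_zero_of_hasSubgaussianMGF {Y : Ω → ℝ} {v : NNReal}
    (h : HasSubgaussianMGF Y v μ) : ∫ ω, Y ω ∂μ = 0 := by
  have hInt : Integrable Y μ := h.integrable
  set m := ∫ ω, Y ω ∂μ with hm
  have hle : ∀ t : ℝ, t * m ≤ v * t ^ 2 / 2 := fun t => by
    have h1 : Real.exp (∫ ω, t * Y ω ∂μ) ≤ ∫ ω, Real.exp (t * Y ω) ∂μ :=
      convexOn_exp.map_integral_le Real.continuous_exp.continuousOn isClosed_univ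
        (ae_of_all _ fun _ => Set.mem_univ _) (hInt.const_mul t) (h.integrable_exp_mul t)
    have h2 := h1.trans (h.mgf_le t)
    rwa [Real.exp_le_exp, integral_const_mul] at h2
  have hv : (0 : ℝ) ≤ v := v.2
  have h3 := hle (m / (v + 1))
  have h4 : m ^ 2 * (v + 1) ≤ v * m ^ 2 / 2 := by
    have : m / (v + 1) * m = m ^ 2 * (v + 1) / (v + 1) ^ 2 := by field_simp
    rw [this, div_pow, mul_div_assoc', div_right_comm, div_le_div_iff_of_pos_right (by positivity)]
      at h3
    exact h3
  have h5 : m ^ 2 ≤ 0 := by nlinarith [sq_nonneg m, mul_nonneg hv (sq_nonneg m)]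
  exact pow_eq_zero_iff two_ne_zero |>.1 (le_antisymm h5 (sq_nonneg m))

/-- The exponential moment of the square of a sub-Gaussian variable. -/
lemma lintegral_exp_sq_le {Y : Ω → ℝ} {v : NNReal} (hY : Measurable Y)
    (h : HasSubgaussianMGF Y v μ) {s : ℝ} (hs : 0 ≤ s) (hsv : 2 * s * v ≤ 3 / 4) :
    ∫⁻ ω, ENNReal.ofReal (Real.exp (s * Y ω ^ 2)) ∂μ ≤ ENNReal.ofReal (1 + 2 * (2 * s * v)) := by
  have hsq : √(2 * s) ^ 2 = 2 * s := Real.sq_sqrt (by positivity)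
  -- An auxiliary standard Gaussian `g` linearizes the square: `exp (s Y²)` is the mean of `exp
  -- (√(2s) Y g)` over `g`. After swapping integrals the sub-Gaussian bound applies for each fixed
  -- `g`.
  have hG : ∀ ω, ENNReal.ofReal (Real.exp (s * Y ω ^ 2)) =
      ∫⁻ g, ENNReal.ofReal (Real.exp (√(2 * s) * Y ω * g)) ∂(gaussianReal 0 1) := fun ω => by
    rw [← ofReal_integral_eq_lintegral_ofReal (integrable_exp_mul_gaussianReal _)
      (ae_of_all _ fun g => by positivity)]
    have := mgf_gaussianReal (p := gaussianReal 0 1) (X := id) (μ := 0) (v := 1) (by simp)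
      (√(2 * s) * Y ω)
    simp only [mgf, id] at this
    rw [this]
    congr 2
    simp only [zero_mul, NNReal.coe_one, one_mul, zero_add, mul_pow, hsq]
    ring
  rw [lintegral_congr hG, lintegral_lintegral_swap (by fun_prop)]
  refine le_trans (lintegral_mono fun g => ?_)
    (lintegral_exp_sq_gaussianReal_le (x := 2 * s * v) (by positivity) hsv)
  have h1 : ∀ ω, √(2 * s) * Y ω * g = √(2 * s) * g * Y ω := fun ω => by ring
  simp only [h1]
  rw [← ofReal_integral_eq_lintegral_ofReal (h.integrable_exp_mul _)
    (ae_of_all _ fun g => by positivity)]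
  refine ENNReal.ofReal_le_ofReal ((h.mgf_le _).trans_eq ?_)
  rw [mul_pow, hsq]
  ring_nf

lemma integrable_exp_sq {Y : Ω → ℝ} {v : NNReal} (hY : Measurable Y)
    (h : HasSubgaussianMGF Y v μ) {s : ℝ} (hs : 0 ≤ s) (hsv : 2 * s * v ≤ 3 / 4) :
    Integrable (fun ω => Real.exp (s * Y ω ^ 2)) μ := by
  refine ⟨by fun_prop, ?_⟩
  rw [hasFiniteIntegral_iff_ofReal (ae_of_all _ fun ω => by positivity)]
  exact (lintegral_exp_sq_le hY h hs hsv).trans_lt ENNReal.ofReal_lt_top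

lemma integral_exp_sq_le {Y : Ω → ℝ} {v : NNReal} (hY : Measurable Y)
    (h : HasSubgaussianMGF Y v μ) {s : ℝ} (hs : 0 ≤ s) (hsv : 2 * s * v ≤ 3 / 4) :
    ∫ ω, Real.exp (s * Y ω ^ 2) ∂μ ≤ 1 + 2 * (2 * s * v) := by
  rw [integral_eq_lintegral_of_nonneg_ae (ae_of_all _ fun ω => by positivity) (by fun_prop)]
  exact ENNReal.toReal_le_of_le_ofReal (by positivity) (lintegral_exp_sq_le hY h hs hsv)

/-- `(1 + z + z²/2)(1 - z + z²/2) = 1 + z⁴/4 ≥ 1`. -/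
lemma exp_neg_le_quadratic {z : ℝ} (hz : 0 ≤ z) : Real.exp (-z) ≤ 1 - z + z ^ 2 / 2 := by
  have h1 := Real.quadratic_le_exp_of_nonneg hz
  rw [Real.exp_neg, inv_le_iff_one_le_mul₀ (Real.exp_pos z)]
  have h2 : 0 ≤ 1 - z + z ^ 2 / 2 := by nlinarith [sq_nonneg (z - 1)]
  nlinarith [mul_le_mul_of_nonneg_left h1 h2, sq_nonneg (z ^ 2)]

/-- The fourth moment in the quadratic expansion is paid for by the exponential moment at `s`. The
gain is linear in `r` and the loss quadratic, so a small `r` wins. -/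
lemma integral_exp_neg_sq_le {Y : Ω → ℝ} {v : NNReal} (hY : Measurable Y)
    (h : HasSubgaussianMGF Y v μ) {s r : ℝ} (hs : 0 < s) (hr : 0 ≤ r) (hsv : 2 * s * v ≤ 3 / 4) :
    ∫ ω, Real.exp (-r * Y ω ^ 2) ∂μ ≤
      1 - r * ∫ ω, Y ω ^ 2 ∂μ + (r / s) ^ 2 * (2 * (2 * s * v)) := by
  have hpt : ∀ ω, Real.exp (-r * Y ω ^ 2) ≤
      1 - r * Y ω ^ 2 + (r / s) ^ 2 * (Real.exp (s * Y ω ^ 2) - 1) := fun ω => by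
    have h1 := exp_neg_le_quadratic (z := r * Y ω ^ 2) (by positivity)
    have h2 := Real.quadratic_le_exp_of_nonneg (x := s * Y ω ^ 2) (by positivity)
    have h3 : (r * Y ω ^ 2) ^ 2 / 2 = (r / s) ^ 2 * ((s * Y ω ^ 2) ^ 2 / 2) := by field_simp
    have h4 : (r / s) ^ 2 * ((s * Y ω ^ 2) ^ 2 / 2) ≤
        (r / s) ^ 2 * (Real.exp (s * Y ω ^ 2) - 1) := by
      have : 0 ≤ s * Y ω ^ 2 := by positivity
      gcongr
      linarith
    rw [neg_mul]
    linarith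
  have hI := integrable_exp_sq hY h hs.le hsv
  have hI2 : Integrable (fun ω => Y ω ^ 2) μ := (h.memLp 2).integrable_sq
  have hI3 : Integrable (fun ω => Real.exp (-r * Y ω ^ 2)) μ := by
    refine Integrable.of_bound (by fun_prop) 1 (ae_of_all _ fun ω => ?_)
    rw [Real.norm_eq_abs, Real.abs_exp, Real.exp_le_one_iff]
    nlinarith [mul_nonneg hr (sq_nonneg (Y ω))]
  have h1 := integral_mono hI3 (((integrable_const 1).sub (hI2.const_mul r)).add
    ((hI.sub (integrable_const 1)).const_mul ((r / s) ^ 2))) hpt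
  refine h1.trans ?_
  rw [integral_add' ((integrable_const 1).sub (hI2.const_mul r))
    ((hI.sub (integrable_const 1)).const_mul ((r / s) ^ 2)),
    integral_sub' (integrable_const 1) (hI2.const_mul r), integral_const_mul, integral_const_mul,
    integral_sub' hI (integrable_const 1)]
  simp only [integral_const, probReal_univ, smul_eq_mul, mul_one]
  have := integral_exp_sq_le hY h hs.le hsv
  gcongr
  linarith

end SubGaussian

/-! ### Concentration and the net argument -/

section Concentration

variable {Ω : Type*} [MeasurableSpace Ω] {μ : Measure Ω}

lemma hasSubgaussianMGF_const_mul {X : Ω → ℝ} {v w : NNReal} (h : HasSubgaussianMGF X v μ) {r : ℝ}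
    (hw : (w : ℝ) = r ^ 2 * v) : HasSubgaussianMGF (fun ω => r * X ω) w μ := by
  have h1 := h.const_mul r
  convert h1
  exact NNReal.eq hw

variable {κ : Type*} [Fintype κ] {W : κ → Ω → ℝ}

lemma mgf_sum_sq (hW : ∀ i, Measurable (W i)) (hind : iIndepFun W μ) (t : ℝ) :
    mgf (fun ω => ∑ i, W i ω ^ 2) μ t = ∏ i, ∫ ω, Real.exp (t * W i ω ^ 2) ∂μ := by
  have h1 : iIndepFun (fun i ω => W i ω ^ 2) μ :=
    hind.comp (fun _ x => x ^ 2) fun _ => by fun_prop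
  have h2 := h1.mgf_sum (t := t) (fun i => by fun_prop) Finset.univ
  rw [Finset.sum_fn] at h2
  simpa [mgf] using h2

variable [IsProbabilityMeasure μ]

/-- The rows of an array of independent random variables are independent. -/
lemma iIndepFun_curry {ι κ : Type*} {X : ι → κ → Ω → ℝ} (mX : ∀ i j, Measurable (X i j))
    (h : iIndepFun (fun (p : ι × κ) ω => X p.1 p.2 ω) μ) :
    iIndepFun (fun i ω j => X i j ω) μ := by
  have hprob : ∀ i j, IsProbabilityMeasure (μ.map (X i j)) :=
    fun i j => Measure.isProbabilityMeasure_map (mX i j).aemeasurable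
  have hrow : ∀ i, iIndepFun (X i) μ := fun i =>
    h.precomp (g := fun j => (i, j)) (fun a b hab => by simpa using hab)
  rw [iIndepFun_iff_map_fun_eq_infinitePi_map (by fun_prop)]
  have h1 := h.map_fun_eq_infinitePi_map (by fun_prop)
  have h2 : (fun ω i j => X i j ω) =
      (MeasurableEquiv.curry ι κ ℝ) ∘ (fun ω (p : ι × κ) => X p.1 p.2 ω) := rfl
  rw [h2, ← Measure.map_map (by fun_prop) (by fun_prop), h1,
    Measure.infinitePi_map_curry (fun i j => μ.map (X i j))]
  congr with i : 1
  rw [(hrow i).map_fun_eq_infinitePi_map (mX i)]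

variable {v : κ → NNReal} {c : κ → ℝ} {R s : ℝ}

/-- Upper tail of the squared norm of a vector of independent sub-Gaussian variables. -/
lemma measureReal_ge_sum_sq_le (hW : ∀ i, Measurable (W i)) (hind : iIndepFun W μ)
    (hsub : ∀ i, HasSubgaussianMGF (W i) (v i) μ) (hv : ∀ i, (v i : ℝ) = R * c i)
    (hc : ∀ i, c i ≤ 1) (hs : 0 < s) (hsR : 2 * s * R = 3 / 4) :
    μ.real {ω | 5 / (2 * s) * ∑ i, c i ≤ ∑ i, W i ω ^ 2} ≤ Real.exp (-∑ i, c i) := by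
  have hsv : ∀ i, 2 * s * v i = 3 / 4 * c i := fun i => by rw [hv, ← hsR]; ring
  have hsv' : ∀ i, 2 * s * v i ≤ 3 / 4 := fun i => by rw [hsv]; linarith [hc i]
  have h1 : iIndepFun (fun i ω => W i ω ^ 2) μ :=
    hind.comp (fun _ x => x ^ 2) fun _ => by fun_prop
  have hI : Integrable (fun ω => Real.exp (s * ∑ i, W i ω ^ 2)) μ := by
    have := h1.integrable_exp_mul_sum (t := s) (fun i => by fun_prop) (s := Finset.univ)
      fun i _ => integrable_exp_sq (hW i) (hsub i) hs.le (hsv' i)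
    simpa using this
  refine (measure_ge_le_exp_mul_mgf _ hs.le hI).trans ?_
  rw [mgf_sum_sq hW hind]
  -- With `T = ∑ i, c i`, the Chernoff exponent is `-(5/2) T + (3/2) T = -T`.
  have h2 : ∏ i, ∫ ω, Real.exp (s * W i ω ^ 2) ∂μ ≤ ∏ i, Real.exp (3 / 2 * c i) := by
    refine Finset.prod_le_prod (fun i _ => integral_nonneg fun ω => (Real.exp_pos _).le)
      fun i _ => ?_
    refine (integral_exp_sq_le (hW i) (hsub i) hs.le (hsv' i)).trans ?_
    rw [hsv]
    linarith [Real.add_one_le_exp (3 / 2 * c i)]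
  rw [← Real.exp_sum, ← Finset.mul_sum] at h2
  refine (mul_le_mul_of_nonneg_left h2 (Real.exp_pos _).le).trans_eq ?_
  rw [← Real.exp_add]
  congr 1
  field_simp
  ring

/-- Lower tail of the squared norm of a vector of independent sub-Gaussian variables. -/
lemma measureReal_sum_sq_le_le (hW : ∀ i, Measurable (W i)) (hind : iIndepFun W μ)
    (hsub : ∀ i, HasSubgaussianMGF (W i) (v i) μ) (hv : ∀ i, (v i : ℝ) = R * c i)
    (hsq : ∀ i, ∫ ω, W i ω ^ 2 ∂μ = c i)
    (hc : ∀ i, c i ≤ 1) (hs : 0 < s) (hsR : 2 * s * R = 3 / 4) :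
    μ.real {ω | ∑ i, W i ω ^ 2 ≤ (∑ i, c i) / 4} ≤ Real.exp (-(s ^ 2 / 12 * ∑ i, c i)) := by
  have hsv : ∀ i, 2 * s * v i = 3 / 4 * c i := fun i => by rw [hv, ← hsR]; ring
  have hsv' : ∀ i, 2 * s * v i ≤ 3 / 4 := fun i => by rw [hsv]; linarith [hc i]
  -- `r = s²/3` minimizes `-r c + (3/2) (r/s)² c`, with value `-s² c / 6`; the threshold `T/4` gives
  -- back `s² T / 12`.
  have hr : 0 ≤ s ^ 2 / 3 := by positivity
  have hI : Integrable (fun ω => Real.exp (-(s ^ 2 / 3) * ∑ i, W i ω ^ 2)) μ := by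
    refine Integrable.of_bound (by fun_prop) 1 (ae_of_all _ fun ω => ?_)
    rw [Real.norm_eq_abs, Real.abs_exp, Real.exp_le_one_iff, neg_mul, neg_nonpos]
    positivity
  refine (measure_le_le_exp_mul_mgf _ (neg_nonpos.2 hr) hI).trans ?_
  rw [mgf_sum_sq hW hind]
  have h2 : ∏ i, ∫ ω, Real.exp (-(s ^ 2 / 3) * W i ω ^ 2) ∂μ ≤
      ∏ i, Real.exp (-(s ^ 2 / 6) * c i) := by
    refine Finset.prod_le_prod (fun i _ => integral_nonneg fun ω => (Real.exp_pos _).le)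
      fun i _ => ?_
    refine (integral_exp_neg_sq_le (hW i) (hsub i) hs hr (hsv' i)).trans ?_
    rw [hsv, hsq]
    have h3 : (s ^ 2 / 3 / s) ^ 2 = s ^ 2 / 9 := by field_simp; norm_num
    rw [h3]
    refine le_trans (le_of_eq ?_) (Real.add_one_le_exp _)
    ring
  rw [← Real.exp_sum, ← Finset.mul_sum] at h2
  refine (mul_le_mul_of_nonneg_left h2 (Real.exp_pos _).le).trans_eq ?_
  rw [← Real.exp_add]
  congr 1
  ring

/-- The squared norm of the image of every unit vector under a matrix with independent sub-Gaussian
entries is comparable to the total variance of a row, up to an exponentially small probability. -/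
lemma measureReal_exists_sum_sq_lt_le {ι : Type*} [Fintype ι] {Y : ι → κ → Ω → ℝ}
    (hY : ∀ j i, Measurable (Y j i)) (hind : iIndepFun (fun (p : ι × κ) ω => Y p.1 p.2 ω) μ)
    (hsub : ∀ j i, HasSubgaussianMGF (Y j i) (v i) μ) (hv : ∀ i, (v i : ℝ) = R * c i)
    (hsq : ∀ j i, ∫ ω, Y j i ω ^ 2 ∂μ = c i)
    (hc : ∀ i, c i ≤ 1) (hc0 : ∀ i, 0 ≤ c i) (hs : 0 < s) (hsR : 2 * s * R = 3 / 4)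
    {ε : ℝ} (hε0 : 0 < ε) (hε : ε ≤ 1 / 2) (hεs : ε * √(5 / (2 * s)) ≤ 1 / 8) :
    μ.real {ω | ∃ u : EuclideanSpace ℝ ι, ‖u‖ = 1 ∧
        ∑ i, (∑ j, u j * Y j i ω) ^ 2 < (∑ i, c i) / 16} ≤
      (1 + 2 / ε) ^ Fintype.card ι *
        (Real.exp (-(s ^ 2 / 12 * ∑ i, c i)) + Real.exp (-∑ i, c i)) := by
  classical
  set T := ∑ i, c i with hT
  have hT0 : 0 ≤ T := Finset.sum_nonneg fun i _ => hc0 i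
  have hrow : iIndepFun (fun i ω j => Y j i ω) μ :=
    iIndepFun_curry (X := fun i j => Y j i) (fun i j => hY j i)
      (hind.precomp (g := Prod.swap) Prod.swap_injective)
  have htail : ∀ u : EuclideanSpace ℝ ι, ‖u‖ = 1 →
      μ.real ({ω | ∑ i, (∑ j, u j * Y j i ω) ^ 2 ≤ T / 4} ∪
        {ω | 5 / (2 * s) * T ≤ ∑ i, (∑ j, u j * Y j i ω) ^ 2}) ≤
      Real.exp (-(s ^ 2 / 12 * T)) + Real.exp (-T) := by
    intro u hu
    have hu2 : ∑ j, u j ^ 2 = 1 := by rw [← EuclideanSpace.real_norm_sq_eq, hu, one_pow]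
    have hcol : ∀ i, iIndepFun (fun j ω => u j * Y j i ω) μ := fun i =>
      (hind.precomp (g := fun j => (j, i)) (fun a b hab => by simpa using hab)).comp
        (fun j x => u j * x) fun j => by fun_prop
    have hWm : ∀ i, Measurable fun ω => ∑ j, u j * Y j i ω := fun i => by fun_prop
    have hWi : iIndepFun (fun i ω => ∑ j, u j * Y j i ω) μ :=
      hrow.comp (fun _ y => ∑ j, u j * y j) fun _ => by fun_prop
    -- As `∑ j, u j ^ 2 = 1`, combining along `u` keeps both the sub-Gaussian proxy and the variance
    -- of each coordinate.
    have hWs : ∀ i, HasSubgaussianMGF (fun ω => ∑ j, u j * Y j i ω) (v i) μ := fun i => by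
      have h1 := HasSubgaussianMGF.sum_of_iIndepFun (hcol i) (s := Finset.univ)
        (c := fun j => Real.toNNReal (u j ^ 2) * v i)
        fun j _ => hasSubgaussianMGF_const_mul (hsub j i) (by simp [sq_nonneg])
      have h2 : ∑ j, Real.toNNReal (u j ^ 2) * v i = v i := by
        rw [← Finset.sum_mul, ← Real.toNNReal_sum_of_nonneg fun j _ => sq_nonneg _, hu2]
        simp
      rwa [h2] at h1
    have hWq : ∀ i, ∫ ω, (∑ j, u j * Y j i ω) ^ 2 ∂μ = c i := fun i => by
      have hm := integral_eq_zero_of_hasSubgaussianMGF (hWs i)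
      rw [← variance_of_integral_eq_zero (hWm i).aemeasurable hm]
      have h2 := IndepFun.variance_sum (X := fun j ω => u j * Y j i ω) (s := Finset.univ) (μ := μ)
        (fun j _ => ((hsub j i).memLp 2).const_mul _)
        (fun j _ k _ hjk => (hcol i).indepFun hjk)
      rw [Finset.sum_fn] at h2
      rw [h2]
      have h3 : ∀ j, Var[fun ω => u j * Y j i ω; μ] = u j ^ 2 * c i := fun j => by
        rw [variance_const_mul, variance_of_integral_eq_zero (hY j i).aemeasurable
          (integral_eq_zero_of_hasSubgaussianMGF (hsub j i)), hsq]
      simp only [h3, ← Finset.sum_mul, hu2, one_mul]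
    exact (measureReal_union_le _ _).trans (add_le_add
      (measureReal_sum_sq_le_le hWm hWi hWs hv hWq hc hs hsR)
      (measureReal_ge_sum_sq_le hWm hWi hWs hv hc hs hsR))
  obtain ⟨N, hN1, hN2, hN3⟩ := exists_net_sphere (EuclideanSpace ℝ ι) hε0
  rw [finrank_euclideanSpace] at hN3
  refine (measureReal_mono (s₂ := ⋃ u ∈ N, ({ω | ∑ i, (∑ j, u j * Y j i ω) ^ 2 ≤ T / 4} ∪
        {ω | 5 / (2 * s) * T ≤ ∑ i, (∑ j, u j * Y j i ω) ^ 2})) ?_ (measure_ne_top _ _)).trans ?_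
  · rintro ω ⟨u, hu, hlt⟩
    by_contra hω
    simp only [Set.mem_iUnion, Set.mem_union, Set.mem_ofPred_eq, not_exists, not_or, not_le] at hω
    let L₀ : EuclideanSpace ℝ ι →ₗ[ℝ] EuclideanSpace ℝ κ :=
      { toFun := fun u => WithLp.toLp 2 fun i => ∑ j, u j * Y j i ω
        map_add' := fun a b => by
          ext i; simp [add_mul, Finset.sum_add_distrib]
        map_smul' := fun a b => by
          ext i; simp [mul_assoc, Finset.mul_sum] }
    have hL : ∀ u, ‖L₀.toContinuousLinearMap u‖ = √(∑ i, (∑ j, u j * Y j i ω) ^ 2) := fun u => by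
      rw [EuclideanSpace.norm_eq]
      simp [L₀]
    -- The net loses at most `2 * (1/8) * √T`, so `√T / 2` drops to `√T / 4`, the root of `T / 16`.
    have hkey := le_norm_apply_of_net L₀.toContinuousLinearMap (a := √(T / 4))
      (b := √(5 / (2 * s) * T)) hε hε0.le (Real.sqrt_nonneg _) hN2
      (fun w hw => by
        rw [hL]
        exact ⟨Real.sqrt_le_sqrt (hω w hw).1.le, Real.sqrt_le_sqrt (hω w hw).2.le⟩) hu
    rw [hL] at hkey
    have h1 : √(T / 4) = √T / 2 := by
      rw [Real.sqrt_div hT0, show (4 : ℝ) = 2 ^ 2 by norm_num, Real.sqrt_sq (by norm_num)]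
    have h2 : √(5 / (2 * s) * T) = √(5 / (2 * s)) * √T := Real.sqrt_mul (by positivity) _
    have h3 : √(T / 16) = √T / 4 := by
      rw [Real.sqrt_div hT0, show (16 : ℝ) = 4 ^ 2 by norm_num, Real.sqrt_sq (by norm_num)]
    have h4 := Real.sqrt_lt_sqrt (Finset.sum_nonneg fun i _ => sq_nonneg _) hlt
    rw [h3] at h4
    rw [h1, h2] at hkey
    nlinarith [mul_le_mul_of_nonneg_right hεs (Real.sqrt_nonneg T)]
  · refine (measureReal_biUnion_finset_le _ _).trans ?_
    refine (Finset.sum_le_card_nsmul _ _ _ fun u hu => htail u (hN1 u hu)).trans ?_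
    rw [nsmul_eq_mul]
    gcongr

end Concentration

/-! ### Margin-adapted dimension and truncated variance -/

section Dimension

variable {d : ℕ} {P : Measure (EuclideanSpace ℝ (Fin d))}

/-- A coordinate subspace of an orthonormal basis witnesses limitedness. -/
lemma isLimited_of_sum_le (a : OrthonormalBasis (Fin d) ℝ (EuclideanSpace ℝ (Fin d)))
    (I : Finset (Fin d)) {b : ℝ} {k : ℕ} (hI : I.card + k = d)
    (hInt : ∀ i, Integrable (fun x => inner ℝ (a i) x ^ 2) P)
    (hb : ∑ i ∈ I, ∫ x, inner ℝ (a i) x ^ 2 ∂P ≤ b) : IsLimited P b k := by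
  classical
  let V : Submodule ℝ (EuclideanSpace ℝ (Fin d)) := Submodule.span ℝ (Set.range fun i : I => a i)
  have hmem : ∀ i ∈ I, a i ∈ V := fun i hi =>
    Submodule.subset_span ⟨⟨i, hi⟩, rfl⟩
  have horth : ∀ i ∉ I, a i ∈ Vᗮ := fun i hi => by
    rw [Submodule.mem_orthogonal]
    intro u hu
    induction hu using Submodule.span_induction with
    | mem x hx =>
      obtain ⟨j, rfl⟩ := hx
      exact a.orthonormal.2 fun h => hi (h ▸ j.2)
    | zero => simp
    | add x y _ _ hx hy => rw [inner_add_left, hx, hy, add_zero]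
    | smul r x _ hx => rw [inner_smul_left, hx, mul_zero]
  have hproj : ∀ x, ‖V.starProjection x‖ ^ 2 = ∑ i ∈ I, inner ℝ (a i) x ^ 2 := fun x => by
    rw [← a.sum_sq_norm_inner_right (V.starProjection x)]
    have h1 : ∀ i, ‖inner ℝ (a i) (V.starProjection x)‖ ^ 2 =
        if i ∈ I then inner ℝ (a i) x ^ 2 else 0 := fun i => by
      rw [← Submodule.inner_starProjection_left_eq_right, Real.norm_eq_abs, sq_abs]
      split_ifs with hi
      · rw [Submodule.starProjection_eq_self_iff.2 (hmem i hi)]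
      · rw [(Submodule.starProjection_apply_eq_zero_iff V).2 (horth i hi)]
        simp
    rw [Finset.sum_congr rfl fun i _ => h1 i]
    simp
  refine ⟨V, ?_, ?_⟩
  · rw [finrank_span_eq_card (b := fun i : I => a i)
      (a.orthonormal.linearIndependent.comp _ Subtype.val_injective), Fintype.card_coe, hI]
  · simp only [hproj]
    rw [← ofReal_integral_eq_lintegral_ofReal (integrable_finsetSum _ fun i _ => hInt i)
      (ae_of_all _ fun x => Finset.sum_nonneg fun i _ => sq_nonneg _),
      integral_finsetSum _ fun i _ => hInt i]
    exact ENNReal.ofReal_le_ofReal hb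

/-- The truncated total variance dominates the margin-adapted dimension. -/
lemma marginAdaptedDim_sub_one_le (a : OrthonormalBasis (Fin d) ℝ (EuclideanSpace ℝ (Fin d)))
    (hInt : ∀ i, Integrable (fun x => inner ℝ (a i) x ^ 2) P) (γ : ℝ) :
    γ ^ 2 * ((marginAdaptedDim γ P : ℝ) - 1) ≤
      ∑ i, min (∫ x, inner ℝ (a i) x ^ 2 ∂P) (γ ^ 2) := by
  classical
  set l : Fin d → ℝ := fun i => ∫ x, inner ℝ (a i) x ^ 2 ∂P with hl
  have hl0 : ∀ i, 0 ≤ min (l i) (γ ^ 2) := fun i =>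
    le_min (integral_nonneg fun x => sq_nonneg _) (sq_nonneg _)
  set k := marginAdaptedDim γ P with hk
  -- The trivial case includes the value `k = 0`; for `k ≥ 2` the integer `k - 1` is still positive,
  -- so minimality excludes it.
  rcases Nat.lt_or_ge k 2 with hk2 | hk2
  · have h1 : (k : ℝ) - 1 ≤ 0 := by
      have : (k : ℝ) ≤ 1 := by exact_mod_cast Nat.lt_succ_iff.1 hk2
      linarith
    exact (mul_nonpos_of_nonneg_of_nonpos (sq_nonneg γ) h1).trans
      (Finset.sum_nonneg fun i _ => hl0 i)
  have hmem : k ∈ {k : ℕ | 1 ≤ k ∧ IsLimited P (γ ^ 2 * k) k} :=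
    Nat.sInf_mem (Nat.nonempty_of_pos_sInf (by change 0 < k; omega))
  have hkd : k ≤ d := by
    obtain ⟨-, V, hV, -⟩ := hmem
    omega
  have hcast : ((k - 1 : ℕ) : ℝ) = k - 1 := by push_cast [show 1 ≤ k by omega]; ring
  have hnot : ¬ IsLimited P (γ ^ 2 * (k - 1 : ℕ)) (k - 1) := fun h =>
    Nat.notMem_of_lt_sInf (s := {k : ℕ | 1 ≤ k ∧ IsLimited P (γ ^ 2 * k) k}) (m := k - 1)
      (by change k - 1 < k; omega) ⟨by omega, h⟩
  rw [hcast] at hnot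
  -- Either `k - 1` coordinates reach `γ²` and suffice alone, or all of `J` fits among `k - 1`
  -- discarded coordinates. In the latter case the rest are untruncated, and failure of limitedness
  -- bounds their sum.
  let J : Finset (Fin d) := Finset.univ.filter fun i => γ ^ 2 ≤ l i
  rcases le_total (k - 1) J.card with hJ | hJ
  · calc γ ^ 2 * ((k : ℝ) - 1) ≤ γ ^ 2 * J.card := by
          rw [← hcast]; gcongr
      _ = ∑ i ∈ J, min (l i) (γ ^ 2) := by
          rw [Finset.sum_congr rfl fun i hi => min_eq_right (Finset.mem_filter.1 hi).2]
          rw [Finset.sum_const, nsmul_eq_mul, mul_comm]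
      _ ≤ _ := Finset.sum_le_univ_sum_of_nonneg hl0
  · obtain ⟨K, hJK, -, hK⟩ := Finset.exists_subsuperset_card_eq (Finset.subset_univ J) hJ
      (by simp; omega)
    have hKc : Kᶜ.card + (k - 1) = d := by
      rw [Finset.card_compl, hK, Fintype.card_fin]; omega
    have hlt : γ ^ 2 * ((k : ℝ) - 1) < ∑ i ∈ Kᶜ, l i := by
      by_contra! hle
      exact hnot (isLimited_of_sum_le a Kᶜ hKc hInt hle)
    refine hlt.le.trans (le_trans (le_of_eq ?_) (Finset.sum_le_univ_sum_of_nonneg (s := Kᶜ) hl0))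
    refine Finset.sum_congr rfl fun i hi => (min_eq_left ?_).symm
    by_contra! hlt'
    exact Finset.mem_compl.1 hi (hJK (Finset.mem_filter.2 ⟨Finset.mem_univ i, hlt'.le⟩))

end Dimension

/-! ### Shattering of random samples -/

/-- The points `x j` are shattered with margin `γ` by homogeneous separators of norm at most one. -/
def Shattered {ι : Type*} {d : ℕ} (γ : ℝ) (x : ι → EuclideanSpace ℝ (Fin d)) : Prop :=
  ∀ y : ι → ℝ, (∀ j, y j ^ 2 = 1) →
    ∃ w : EuclideanSpace ℝ (Fin d), ‖w‖ ≤ 1 ∧ ∀ j, γ < y j * inner ℝ (x j) w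

/-- An i.i.d. sample from a sub-Gaussian product distribution is shattered, up to an exponentially
small probability, as long as its size is a small fraction of the margin-adapted dimension. -/
lemma exists_measureReal_not_shattered_le {ρ : ℝ} (hρ : 0 < ρ) :
    ∃ κ L : ℝ, 0 < κ ∧ 1 < L ∧
      ∀ (d : ℕ) (P : Measure (EuclideanSpace ℝ (Fin d))), InFamily ρ P → ∀ γ : ℝ, 0 < γ →
      ∀ (ι Ω : Type) [Fintype ι] [MeasurableSpace Ω] (μ : Measure Ω) [IsProbabilityMeasure μ]
        (X : ι → Ω → EuclideanSpace ℝ (Fin d)), (∀ j, Measurable (X j)) → iIndepFun X μ →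
        (∀ j, μ.map (X j) = P) →
        16 * (Fintype.card ι : ℝ) < marginAdaptedDim γ P - 1 →
        μ.real {ω | ¬ Shattered γ fun j => X j ω} ≤
          2 * (L ^ Fintype.card ι * Real.exp (-(κ * (marginAdaptedDim γ P - 1)))) := by
  -- Chosen so that `2 s ρ² = 3/4`, the limit of the exponential moment bounds.
  set s : ℝ := 3 / (8 * ρ ^ 2) with hs_def
  have hs : 0 < s := by positivity
  set r := √(5 / (2 * s)) with hr_def
  have hr : 0 < r := Real.sqrt_pos.2 (by positivity)
  set ε : ℝ := min (1 / 2) (1 / (8 * r)) with hε_def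
  have hε0 : 0 < ε := by positivity
  have hεr : ε * r ≤ 1 / 8 := by
    calc ε * r ≤ 1 / (8 * r) * r := by gcongr; exact min_le_right _ _
      _ = 1 / 8 := by field_simp
  refine ⟨min (s ^ 2 / 12) 1, 1 + 2 / ε, by positivity, by linarith [show 0 < 2 / ε by positivity],
    ?_⟩
  rintro d P ⟨B, -, a, hind, hsub⟩ γ hγ ι Ω _ _ μ _ X hX hXind hlaw hcard
  have hmeas : ∀ i, Measurable fun x : EuclideanSpace ℝ (Fin d) => inner ℝ (a i) x :=
    fun i => by fun_prop
  have hInt : ∀ i, Integrable (fun x => inner ℝ (a i) x ^ 2) P := fun i =>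
    (HasSubgaussianMGF.memLp (hsub i).1 2).integrable_sq
  have hdim := marginAdaptedDim_sub_one_le a hInt γ
  set l : Fin d → ℝ := fun i => ∫ x, inner ℝ (a i) x ^ 2 ∂P with hl
  have hl0 : ∀ i, 0 ≤ l i := fun i => integral_nonneg fun x => sq_nonneg _
  set k := marginAdaptedDim γ P
  -- `c i` is the truncated variance in units of `γ²`, and `τ i` the squared scaling that produces
  -- it; for a degenerate coordinate `0 / 0 = 0` is the right value.
  let c : Fin d → ℝ := fun i => min (l i) (γ ^ 2) / γ ^ 2
  let τ : Fin d → ℝ := fun i => c i / l i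
  have hc0 : ∀ i, 0 ≤ c i := fun i => div_nonneg (le_min (hl0 i) (sq_nonneg _)) (sq_nonneg _)
  have hc1 : ∀ i, c i ≤ 1 := fun i => (div_le_one (by positivity)).2 (min_le_right _ _)
  have hτ0 : ∀ i, 0 ≤ τ i := fun i => div_nonneg (hc0 i) (hl0 i)
  have hτl : ∀ i, τ i * l i = c i := fun i => by
    rcases eq_or_ne (l i) 0 with h0 | h0
    · simp only [τ, c, h0, mul_zero, min_eq_left (sq_nonneg γ), zero_div]
    · exact div_mul_cancel₀ _ h0
  have hτ1 : ∀ i, τ i ≤ 1 / γ ^ 2 := fun i => by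
    refine div_le_of_le_mul₀ (hl0 i) (by positivity) ?_
    rw [one_div_mul_eq_div]
    exact div_le_div_of_nonneg_right (min_le_left _ _) (sq_nonneg _)
  have hT : (k : ℝ) - 1 ≤ ∑ i, c i := by
    rw [← Finset.sum_div, le_div_iff₀ (by positivity), mul_comm]
    exact hdim
  let Y : ι → Fin d → Ω → ℝ := fun j i ω => √(τ i) * inner ℝ (a i) (X j ω)
  have hYm : ∀ j i, Measurable (Y j i) := fun j i => by
    have := (hmeas i).comp (hX j)
    exact this.const_mul _
  have hYind : iIndepFun (fun (p : ι × Fin d) ω => Y p.1 p.2 ω) μ := by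
    refine iIndepFun_uncurry' hYm ?_ fun j => ?_
    · exact hXind.comp (fun _ x i => √(τ i) * inner ℝ (a i) x) fun _ => by fun_prop
    · have h1 : iIndepFun (fun i ω => inner ℝ (a i) (X j ω)) μ := by
        have := Measure.isProbabilityMeasure_map (μ := μ) (hX j).aemeasurable
        have h2 := hind
        rw [← hlaw j] at h2
        rw [iIndepFun_iff_map_fun_eq_pi_map (fun i => (hmeas i).aemeasurable)] at h2
        refine (iIndepFun_iff_map_fun_eq_pi_map (f := fun i ω => inner ℝ (a i) (X j ω))
          (fun i => ((hmeas i).comp (hX j)).aemeasurable)).2 ?_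
        rw [Measure.map_map (by fun_prop) (hX j)] at h2
        refine h2.trans ?_
        congr with i : 1
        rw [Measure.map_map (hmeas i) (hX j)]
        rfl
      exact h1.comp (fun i x => √(τ i) * x) fun i => by fun_prop
  have hYsub : ∀ j i, HasSubgaussianMGF (Y j i) (Real.toNNReal (ρ ^ 2 * c i)) μ := fun j i => by
    have h1 : HasSubgaussianMGF (fun x => inner ℝ (a i) x)
        (Real.toNNReal ((ρ * √(l i)) ^ 2)) (μ.map (X j)) := by
      rw [hlaw j]; exact (hsub i).2
    have h2 := HasSubgaussianMGF.of_map (hX j).aemeasurable h1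
    refine hasSubgaussianMGF_const_mul h2 ?_
    rw [Real.coe_toNNReal _ (mul_nonneg (sq_nonneg _) (hc0 i)), Real.coe_toNNReal _ (sq_nonneg _),
      mul_pow, Real.sq_sqrt (hl0 i), Real.sq_sqrt (hτ0 i), ← hτl i]
    ring
  have hYsq : ∀ j i, ∫ ω, Y j i ω ^ 2 ∂μ = c i := fun j i => by
    simp only [Y, mul_pow, Real.sq_sqrt (hτ0 i)]
    rw [integral_const_mul, ← hτl i]
    congr 1
    simp only [hl]
    rw [← hlaw j, integral_map (hX j).aemeasurable (by fun_prop)]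
  have hbad := measureReal_exists_sum_sq_lt_le hYm hYind hYsub
    (fun i => Real.coe_toNNReal _ (mul_nonneg (sq_nonneg _) (hc0 i))) hYsq hc1 hc0 hs
    (by rw [hs_def]; field_simp; norm_num) hε0 (min_le_left _ _) hεr
  refine (measureReal_mono ?_ (measure_ne_top _ _)).trans (hbad.trans ?_)
  · intro ω hω
    by_contra hcon
    refine hω fun y hy => ?_
    refine exists_norm_le_one_margin (fun j => X j ω) hγ (Λ := γ ^ 2 * ((∑ i, c i) / 16)) ?_ ?_ y hy
    · rw [mul_comm]
      have : (Fintype.card ι : ℝ) < (∑ i, c i) / 16 := by linarith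
      gcongr
    · intro u hu
      have h1 : (∑ i, c i) / 16 ≤ ∑ i, (∑ j, u j * Y j i ω) ^ 2 := by
        by_contra! hlt
        exact hcon ⟨u, hu, hlt⟩
      -- Since `τ i ≤ 1 / γ²`, a lower bound for the rescaled vectors passes to the original ones
      -- with a factor `γ²`.
      have h2 : ∀ i, (∑ j, u j * Y j i ω) ^ 2 ≤
          1 / γ ^ 2 * inner ℝ (a i) (∑ j, u j • X j ω) ^ 2 := fun i => by
        have h3 : ∑ j, u j * Y j i ω = √(τ i) * inner ℝ (a i) (∑ j, u j • X j ω) := by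
          rw [inner_sum, Finset.mul_sum]
          refine Finset.sum_congr rfl fun j _ => ?_
          rw [inner_smul_right]
          simp only [Y]
          ring
        rw [h3, mul_pow, Real.sq_sqrt (hτ0 i)]
        gcongr
        exact hτ1 i
      have h4 := h1.trans (Finset.sum_le_sum fun i _ => h2 i)
      rw [← Finset.mul_sum] at h4
      have h5 := a.sum_sq_norm_inner_right (∑ j, u j • X j ω)
      simp only [Real.norm_eq_abs, sq_abs] at h5
      rw [h5, one_div_mul_eq_div, le_div_iff₀ (by positivity)] at h4
      linarith
  · have hk0 : 0 ≤ (k : ℝ) - 1 := by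
      have : (0 : ℝ) ≤ Fintype.card ι := by positivity
      linarith
    have hT0 : 0 ≤ ∑ i, c i := hk0.trans hT
    have h1 : min (s ^ 2 / 12) 1 * ((k : ℝ) - 1) ≤ s ^ 2 / 12 * ∑ i, c i := by
      gcongr; exact min_le_left _ _
    have h2 : min (s ^ 2 / 12) 1 * ((k : ℝ) - 1) ≤ ∑ i, c i := by
      calc _ ≤ 1 * ∑ i, c i := by gcongr; exact min_le_right _ _
        _ = _ := one_mul _
    have h3 := Real.exp_le_exp.2 (neg_le_neg h1)
    have h4 := Real.exp_le_exp.2 (neg_le_neg h2)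
    rw [mul_left_comm]
    gcongr
    linarith

/-! ### From shattering to a bad minimizer -/

/-- Error counts are natural numbers, so the minimum is attained without any compactness. -/
lemma exists_isMinOn_empMarginLoss {𝒳 : Type*} {H : Set (𝒳 → ℝ)} (hH : H.Nonempty) (γ : ℝ) {n : ℕ}
    (S : Fin n → 𝒳 × Label) :
    ∃ h ∈ H, ∀ g ∈ H, empMarginLoss γ h S ≤ empMarginLoss γ g S := by
  let f : (𝒳 → ℝ) → ℕ := fun h =>
    (Finset.univ.filter fun i => ((S i).2 : ℝ) * h (S i).1 ≤ γ).card
  obtain ⟨h, hh, hmin⟩ := WellFounded.has_min (measure f).wf H hH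
  refine ⟨h, hh, fun g hg => ?_⟩
  have h1 : f h ≤ f g := not_lt.1 (hmin g hg)
  unfold empMarginLoss
  gcongr

lemma one_le_marginLoss_add_marginLoss_neg {𝒳 : Type*} [MeasurableSpace 𝒳]
    (D : Measure (𝒳 × Label)) [IsProbabilityMeasure D] (h : 𝒳 → ℝ) :
    1 ≤ marginLoss 0 h D + marginLoss 0 (fun x => -h x) D := by
  unfold marginLoss
  refine le_trans ?_ (measureReal_union_le _ _)
  refine (probReal_univ (μ := D)).symm.le.trans (measureReal_mono fun p _ => ?_)
  rcases le_total ((p.2 : ℝ) * h p.1) 0 with hp | hp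
  · exact Or.inl hp
  · exact Or.inr (by simpa using hp)

lemma measurePreserving_comp_inl {ι κ 𝒵 : Type*} [Fintype ι] [Fintype κ] [MeasurableSpace 𝒵]
    (D : Measure 𝒵) [IsProbabilityMeasure D] :
    MeasurePreserving (fun (S : ι ⊕ κ → 𝒵) i => S (Sum.inl i)) (Measure.pi fun _ => D)
      (Measure.pi fun _ => D) :=
  (measurePreserving_fst (μ := Measure.pi fun _ : ι => D) (ν := Measure.pi fun _ : κ => D)).comp
    (measurePreserving_sumPiEquivProdPi fun _ : ι ⊕ κ => D)

lemma measurePreserving_comp_inr {ι κ 𝒵 : Type*} [Fintype ι] [Fintype κ] [MeasurableSpace 𝒵]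
    (D : Measure 𝒵) [IsProbabilityMeasure D] :
    MeasurePreserving (fun (S : ι ⊕ κ → 𝒵) i => S (Sum.inr i)) (Measure.pi fun _ => D)
      (Measure.pi fun _ => D) :=
  (measurePreserving_snd (μ := Measure.pi fun _ : ι => D) (ν := Measure.pi fun _ : κ => D)).comp
    (measurePreserving_sumPiEquivProdPi fun _ : ι ⊕ κ => D)

/-- Needed for the event that a bad minimizer exists, whose measurability is not established; for
arbitrary sets the inequality survives. -/
lemma measureReal_preimage_le {α β : Type*} [MeasurableSpace α] [MeasurableSpace β]
    {μ : Measure α} {ν : Measure β} [IsProbabilityMeasure ν] {f : α → β}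
    (hf : MeasurePreserving f μ ν) (E : Set β) : μ.real (f ⁻¹' E) ≤ ν.real E := by
  have h1 := Measure.le_map_apply (μ := μ) hf.measurable.aemeasurable E
  rw [hf.map_eq] at h1
  exact ENNReal.toReal_mono (measure_ne_top _ _) h1

lemma empMarginLoss_eq_zero {𝒳 : Type*} {γ : ℝ} {h : 𝒳 → ℝ} {n : ℕ} {S : Fin n → 𝒳 × Label}
    (hS : ∀ i, γ < ((S i).2 : ℝ) * h (S i).1) : empMarginLoss γ h S = 0 := by
  unfold empMarginLoss
  rw [Finset.filter_false_of_mem fun i _ => not_le.2 (hS i)]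
  simp

/-- If two independent samples of size `n` are jointly shattered with probability more than one half,
then some margin-error minimization algorithm has error at least one half with probability more than
one quarter: a separator that is right on one half of the double sample and wrong on the other one
is, up to sign, a minimizer for both halves. -/
lemma exists_isMEM_half_le_highProbLoss {d : ℕ} (D : Measure (EuclideanSpace ℝ (Fin d) × Label))
    [IsProbabilityMeasure D] {γ : ℝ} {n : ℕ}
    (hsh : (Measure.pi fun _ : Fin n ⊕ Fin n => D).real
      {S | ¬ Shattered γ fun j => (S j).1} < 1 / 2) :
    ∃ A : ℝ → LearningAlgorithm (EuclideanSpace ℝ (Fin d)), IsMEM (linearClass d) A ∧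
      1 / 2 ≤ highProbLoss (A γ) D n (1 / 4) := by
  classical
  let IsMin (γ : ℝ) (n : ℕ) (S : Fin n → EuclideanSpace ℝ (Fin d) × Label)
      (h : EuclideanSpace ℝ (Fin d) → ℝ) : Prop :=
    h ∈ linearClass d ∧ ∀ g ∈ linearClass d, empMarginLoss γ h S ≤ empMarginLoss γ g S
  -- The adversarial choice: a minimizer with error at least `1/2` whenever there is one.
  have hex : ∀ γ n S, ∃ h, IsMin γ n S h ∧
      ((∃ h', IsMin γ n S h' ∧ 1 / 2 ≤ marginLoss 0 h' D) → 1 / 2 ≤ marginLoss 0 h D) := by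
    intro γ n S
    by_cases hbad : ∃ h', IsMin γ n S h' ∧ 1 / 2 ≤ marginLoss 0 h' D
    · obtain ⟨h, h1, h2⟩ := hbad
      exact ⟨h, h1, fun _ => h2⟩
    · obtain ⟨h, h1, h2⟩ := exists_isMinOn_empMarginLoss
        (H := linearClass d) ⟨_, 0, by simp, rfl⟩ γ S
      exact ⟨h, ⟨h1, h2⟩, fun h' => absurd h' hbad⟩
  choose A hA hA' using hex
  refine ⟨A, fun γ _ n _ S => hA γ n S, ?_⟩
  let E : Set (Fin n → EuclideanSpace ℝ (Fin d) × Label) :=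
    {S | ∃ h', IsMin γ n S h' ∧ 1 / 2 ≤ marginLoss 0 h' D}
  have hmin : ∀ (S : Fin n → EuclideanSpace ℝ (Fin d) × Label) (w : EuclideanSpace ℝ (Fin d)),
      ‖w‖ ≤ 1 → (∀ i, γ < ((S i).2 : ℝ) * inner ℝ (S i).1 w) →
      IsMin γ n S fun x => inner ℝ x w := fun S w hw hS => by
    refine ⟨⟨w, hw, rfl⟩, fun g _ => ?_⟩
    rw [empMarginLoss_eq_zero hS]
    unfold empMarginLoss
    positivity
  have hlabel : ∀ y : Label, (y : ℝ) ^ 2 = 1 := fun y => by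
    rcases y.2 with h | h <;> rw [h] <;> norm_num
  have hcover : (Set.univ : Set (Fin n ⊕ Fin n → EuclideanSpace ℝ (Fin d) × Label)) ⊆
      {S | ¬ Shattered γ fun j => (S j).1} ∪
        ((fun S i => S (Sum.inl i)) ⁻¹' E ∪ (fun S i => S (Sum.inr i)) ⁻¹' E) := by
    intro S _
    by_cases hS : Shattered γ fun j => (S j).1
    swap
    · exact Or.inl hS
    right
    -- True labels on the first half, flipped ones on the second.
    obtain ⟨w, hw, hwS⟩ := hS
      (Sum.elim (fun i => ((S (Sum.inl i)).2 : ℝ)) fun i => -((S (Sum.inr i)).2 : ℝ)) (by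
        rintro (j | j)
        · simpa using hlabel _
        · simpa using hlabel _)
    have h1 := hmin (fun i => S (Sum.inl i)) w hw fun i => by simpa using hwS (Sum.inl i)
    have h2 := hmin (fun i => S (Sum.inr i)) (-w) (by simpa using hw) fun i => by
      simpa using hwS (Sum.inr i)
    have h3 := one_le_marginLoss_add_marginLoss_neg D fun x => inner ℝ x w
    simp only [inner_neg_right] at h2
    by_cases h4 : 1 / 2 ≤ marginLoss 0 (fun x => inner ℝ x w) D
    · exact Or.inl ⟨_, h1, h4⟩
    · exact Or.inr ⟨_, h2, by linarith⟩
  have hE : 1 / 4 < (Measure.pi fun _ : Fin n => D).real E := by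
    have h1 := measureReal_mono (μ := Measure.pi fun _ : Fin n ⊕ Fin n => D) hcover
    rw [probReal_univ] at h1
    have h2 := h1.trans ((measureReal_union_le _ _).trans
      (add_le_add_right (measureReal_union_le _ _) _))
    have h3 := measureReal_preimage_le (measurePreserving_comp_inl (ι := Fin n) (κ := Fin n) D) E
    have h4 := measureReal_preimage_le (measurePreserving_comp_inr (ι := Fin n) (κ := Fin n) D) E
    linarith
  -- The infimum is over a nonempty set: no loss reaches `2`.
  refine le_csInf ⟨2, by norm_num, ?_⟩ ?_
  · have : {S | 2 ≤ marginLoss 0 (A γ n S) D} = ∅ := by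
      refine Set.eq_empty_of_forall_notMem fun S hS => ?_
      have h1 : (2 : ℝ) ≤ marginLoss 0 (A γ n S) D := hS
      have h2 : marginLoss 0 (A γ n S) D ≤ 1 := measureReal_le_one
      linarith
    rw [this]
    simp
  · rintro ε ⟨-, hε⟩
    by_contra! hlt
    refine absurd (hE.trans_le ((measureReal_mono fun S hS => ?_).trans hε)) (lt_irrefl _)
    exact hlt.le.trans (hA' γ n S hS)

end MarginLearning

/-! ### Choice of constants and conclusion -/

open MarginLearning in
theorem mainTheorem3 (ρ : ℝ) (hρ : 0 < ρ) :
    ∃ β C : ℝ, 0 < β ∧ 0 ≤ C ∧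
      ∀ (d : ℕ) (D : Measure (EuclideanSpace ℝ (Fin d) × MarginLearning.Label)),
        IsProbabilityMeasure D →
        MarginLearning.InFamily ρ (D.map Prod.fst) →
        ∀ γ : ℝ, 0 < γ →
        ∀ ε : ℝ, ε < 1 / 2 - MarginLearning.bestMarginLoss (MarginLearning.linearClass d) γ D →
          ((β * (MarginLearning.marginAdaptedDim γ (D.map Prod.fst) : ℝ) - C : ℝ) : EReal) ≤
            (((MarginLearning.sampleComplexity (MarginLearning.linearClass d) ε γ D (1 / 4) :
              ℕ∞) : ENNReal) : EReal) := by
  obtain ⟨κ, L, hκ, hL, hsh⟩ := exists_measureReal_not_shattered_le hρ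
  have hlogL : 0 < Real.log L := Real.log_pos hL
  have hlog4 : 0 < Real.log 4 := Real.log_pos (by norm_num)
  -- For `m < β k - C`, the entries `1/32` give `16 * (2m) < k - 1`; the others give `L^(2m) * exp
  -- (-κ (k - 1)) < 1/4`, so shattering of `2m` points fails with probability below `1/2`.
  refine ⟨min (1 / 32) (κ / (2 * Real.log L)),
    max (1 / 32) ((κ + Real.log 4) / (2 * Real.log L)), by positivity, by positivity, ?_⟩
  intro d D hD hfam γ hγ ε hε
  set k := marginAdaptedDim γ (D.map Prod.fst) with hk
  set x := min (1 / 32) (κ / (2 * Real.log L)) * (k : ℝ) -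
    max (1 / 32) ((κ + Real.log 4) / (2 * Real.log L)) with hx
  have hkey : ((⌈x⌉₊ : ℕ) : ℕ∞) ≤ sampleComplexity (linearClass d) ε γ D (1 / 4) := by
    -- Bounding every admissible `m` also covers the case where there is none and the infimum is
    -- `⊤`.
    refine le_iInf₂ fun m hm => ?_
    obtain ⟨-, hm⟩ := hm
    rw [Nat.cast_le, Nat.ceil_le]
    by_contra! hlt
    have hx1 : x ≤ 1 / 32 * k - 1 / 32 := by
      rw [hx]
      gcongr
      · exact min_le_left _ _
      · exact le_max_left _ _
    have hx2 : x ≤ κ / (2 * Real.log L) * k - (κ + Real.log 4) / (2 * Real.log L) := by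
      rw [hx]
      gcongr
      · exact min_le_right _ _
      · exact le_max_right _ _
    have hx3 : 2 * Real.log L * x ≤ κ * k - (κ + Real.log 4) := by
      calc 2 * Real.log L * x
          ≤ 2 * Real.log L * (κ / (2 * Real.log L) * k -
              (κ + Real.log 4) / (2 * Real.log L)) := by gcongr
        _ = _ := by field_simp
    have hx4 : 2 * Real.log L * m < 2 * Real.log L * x := by gcongr
    have hprob := hsh d (D.map Prod.fst) hfam γ hγ (Fin m ⊕ Fin m)
      (Fin m ⊕ Fin m → EuclideanSpace ℝ (Fin d) × Label) (Measure.pi fun _ => D)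
      (fun j S => (S j).1) (fun j => by fun_prop)
      (iIndepFun_pi (X := fun _ => Prod.fst) fun _ => measurable_fst.aemeasurable)
      (fun j => by
        have h1 := (measurePreserving_eval (fun _ : Fin m ⊕ Fin m => D) j).map_eq
        conv_rhs => rw [← h1]
        rw [Measure.map_map measurable_fst (measurable_pi_apply j)]
        rfl)
      (by
        simp only [Fintype.card_sum, Fintype.card_fin]
        push_cast
        linarith)
    have hsmall : 2 * (L ^ Fintype.card (Fin m ⊕ Fin m) * Real.exp (-(κ * ((k : ℝ) - 1)))) <
        1 / 2 := by
      have h1 : L ^ Fintype.card (Fin m ⊕ Fin m) = Real.exp (2 * Real.log L * m) := by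
        rw [Fintype.card_sum, Fintype.card_fin, ← Real.exp_log (zero_lt_one.trans hL),
          ← Real.exp_nat_mul, Real.log_exp]
        push_cast
        ring_nf
      have h2 : Real.exp (2 * Real.log L * m + -(κ * ((k : ℝ) - 1))) < 1 / 4 := by
        rw [← Real.exp_log (show (0 : ℝ) < 1 / 4 by norm_num), Real.exp_lt_exp, one_div,
          Real.log_inv]
        linarith
      rw [h1, ← Real.exp_add]
      linarith
    -- Testing `n = m` suffices: the excess error of `A` is at least `1/2 - ℓ*`, which exceeds `ε`.
    obtain ⟨A, hA, hhalf⟩ := exists_isMEM_half_le_highProbLoss D (hprob.trans_lt hsmall)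
    have := hm A hA m le_rfl
    linarith
  calc ((x : ℝ) : EReal) ≤ ((⌈x⌉₊ : ℝ) : EReal) := EReal.coe_le_coe_iff.2 (Nat.le_ceil x)
    _ = ((((⌈x⌉₊ : ℕ) : ℕ∞) : ENNReal) : EReal) := by
      rw [ENat.toENNReal_coe, ← ENNReal.ofReal_natCast, EReal.coe_ennreal_ofReal,
        max_eq_left (Nat.cast_nonneg _)]
    _ ≤ _ := by
      rw [EReal.coe_ennreal_le_coe_ennreal_iff, ENat.toENNReal_le]
      exact hkey
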